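/- For a finite group $G$ let $\mathfrak D(G)$ be the smallest dimension of a non-trivial irreducible complex representation of $G$. For $S\subseteq G$ with $S=S^{-1}$, the adjacency operator of the Cayley graph $\mathrm{Cay}(G,S)$ is the operator on $\ell^2(G)$ (complex-valued functions, counting measure) given by $(\mathcal A f)(g)=\sum_{s\in S}f(gs)$. For $\varphi\in\ell^2(G)$ with $\|\varphi\|_{\ell^2}=1$ let $\mu_\varphi=\sum_{g\in G}|\varphi(g)|^2\delta_g$. For every $c>0$ there is a constant $K>0$, depending only on $c$, such that for every $\eta>0$ there is an $N_0$, depending only on $c$ and $\eta$, with the following property. Let $0<\varepsilon<s$ be real numbers with $\eta=s-\varepsilon$, let $C>0$, let $G$ be a finite group with $|G|\ge N_0$ and $\mathfrak D(G)\ge |G|^s$, let $S\subseteq G$ be a symmetric subset ($S=S^{-1}$), and let $(A_i)_i$ be a family of subsets partitioning $G$ such that $c|G|^{1-\eta}\le |A_i|\le C|G|^{1-\eta}$ for all $i$. Then there is an orthonormal basis $\mathcal B$ of $\ell^2(G)$ consisting of real-valued eigenfunctions of the adjacency operator of $\mathrm{Cay}(G,S)$ such that, for every $\varphi\in\mathcal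 B$ and every $i$, $$\left|\mu_\varphi[A_i]-\frac{|A_i|}{|G|}\right|\le \frac{K\log|G|}{|G|^{\varepsilon/2}}\cdot\frac{|A_i|}{|G|}.$$ -/

import Mathlib

open MeasureTheory

noncomputable section

/-- The quasirandomness parameter `𝔇(G)`: the smallest dimension of a non-trivial irreducible
complex representation of `G`. Every finite-dimensional complex representation is isomorphic to one
on `ℂᵈ`, and an irreducible representation is isomorphic to the trivial one exactly when every group
element acts as the identity. (For the one-element group there is no such representation and the
value is the junk value `0`.) -/
def quasirandomDegree (G : Type*) [Group G] : ℕ :=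
  sInf {d : ℕ | ∃ ρ : Representation ℂ G (Fin d → ℂ), ρ.IsIrreducible ∧ ¬ ρ.IsTrivial}

/-- The adjacency operator of the Cayley graph `Cay(G, S)` on the complex Hilbert space `ℓ²(G)`
(counting measure): the vertices `g` and `h` are joined exactly when `h = g * s` for some `s ∈ S`,
so that `(𝒜 f)(g) = ∑_{s ∈ S} f(g s)`. -/
def cayleyAdjacency {G : Type*} [Group G] [Fintype G] (S : Finset G) :
    EuclideanSpace ℂ G →ₗ[ℂ] EuclideanSpace ℂ G where
  toFun f := WithLp.toLp 2 fun g => ∑ s ∈ S, f (g * s)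
  map_add' f h := by
    ext g
    simp [Finset.sum_add_distrib]
  map_smul' a f := by
    ext g
    simp [Finset.mul_sum]

/-- The quantum measure `μ_φ = ∑_v |φ(v)|² δ_v` on the finite set `G`, all of whose subsets are
measurable. -/
def quantumMeasure {G : Type*} [Fintype G] (φ : EuclideanSpace ℂ G) : @Measure G ⊤ :=
  ∑ v, ENNReal.ofReal (‖φ v‖ ^ 2) • @Measure.dirac G ⊤ v

/-- The number `μ_φ[A]`, which equals `∑_{v ∈ A} |φ(v)|²`. -/
def quantumMass {G : Type*} [Fintype G] (φ : EuclideanSpace ℂ G) (A : Finset G) : ℝ :=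
  (quantumMeasure φ (A : Set G)).toReal

theorem quantumMass_eq_sum {G : Type*} [Fintype G] (φ : EuclideanSpace ℂ G) (A : Finset G) :
    quantumMass φ A = ∑ v ∈ A, ‖φ v‖ ^ 2 := by
  classical
  let _ : MeasurableSpace G := ⊤
  have h : quantumMeasure φ (A : Set G)
      = ∑ v, ENNReal.ofReal (‖φ v‖ ^ 2) * (A : Set G).indicator 1 v := by
    unfold quantumMeasure
    rw [Measure.finsetSum_apply]
    refine Finset.sum_congr rfl fun v _ => ?_
    rw [Measure.smul_apply, Measure.dirac_apply' v (MeasurableSpace.measurableSet_top), smul_eq_mul]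
  have h2 : quantumMeasure φ (A : Set G) = ∑ v ∈ A, ENNReal.ofReal (‖φ v‖ ^ 2) := by
    rw [h]
    simp [Set.indicator_apply, Finset.sum_ite_mem]
  rw [quantumMass, h2, ENNReal.toReal_sum (fun _ _ => ENNReal.ofReal_ne_top)]
  exact Finset.sum_congr rfl fun v _ => ENNReal.toReal_ofReal (by positivity)

end

/-! The adjacency operator sums over right translates, so its real eigenspaces are invariant under
left translation. An invariant space `W` of dimension `d` has a translation-invariant reproducing
kernel, so the squares of any orthonormal basis sum to the constant `d / n` on the group, `n = |G|`.
If moreover `W` is nonzero and orthogonal to the constants, its complexification contains a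
non-trivial irreducible representation, hence `d ≥ 𝔇(G) ≥ n ^ s`.

In such a `W` a Haar-random orthonormal basis works. A row of a Haar orthogonal matrix has the law
of a normalized sign vector times that matrix, so the mass of a random basis vector on `A` can be
studied with random signs. Its mean is `|A| / n`, and its fluctuation is an off-diagonal quadratic
form in the signs whose squared Frobenius norm is at most `|A| / (n d)`, by Bessel. Bonami-type
bounds on moments of order `2p`, with `p ≈ log n`, leave room for a union bound over all basis
vectors and all sets (`exists_orthonormalBasis_equidistributed`, `union_bound_lt_one`).

Constants may share their eigenvalue with other eigenfunctions. Adding a multiple of the all-ones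
operator separates them while preserving symmetry and left invariance
(`exists_perturbedAdjacency_eigenspace`). -/

/-! ### Moment bounds for linear and quadratic forms in random signs. -/

/-- Two-point hypercontractivity. Raising the exponent by two produces the cross term `g * h * (a -
b)`, so the induction carries a bound on that term as well; `q ≥ 4 * p` absorbs its growth, which is
linear in `m`. -/
theorem twoPoint_pow_le (g h q : ℝ) (p : ℕ) (hq : (4 * p : ℝ) ≤ q) :
    ((g + h) ^ (2 * p) + (g - h) ^ (2 * p)) / 2 ≤ (g ^ 2 + q * h ^ 2) ^ p := by
  have hq0 : 0 ≤ q := le_trans (by positivity) hq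
  have key : ∀ m : ℕ, m ≤ p →
      ((g + h) ^ (2 * m) + (g - h) ^ (2 * m)) / 2 ≤ (g ^ 2 + q * h ^ 2) ^ m ∧
      g * h * ((g + h) ^ (2 * m) - (g - h) ^ (2 * m)) ≤ 4 * m * h ^ 2 * (g ^ 2 + q * h ^ 2) ^ m := by
    intro m
    induction m with
    | zero => intro _; simp
    | succ m ih =>
      intro hm
      obtain ⟨h1, h2⟩ := ih (by omega)
      set X := (g ^ 2 + q * h ^ 2) ^ m with hX
      have hX0 : 0 ≤ X := by positivity
      have hmp : (m : ℝ) + 1 ≤ p := by exact_mod_cast hm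
      have e1 : (g + h) ^ (2 * (m + 1)) = (g + h) ^ (2 * m) * (g ^ 2 + h ^ 2 + 2 * (g * h)) := by
        rw [show 2 * (m + 1) = 2 * m + 2 by ring, pow_add]; ring
      have e2 : (g - h) ^ (2 * (m + 1)) = (g - h) ^ (2 * m) * (g ^ 2 + h ^ 2 - 2 * (g * h)) := by
        rw [show 2 * (m + 1) = 2 * m + 2 by ring, pow_add]; ring
      rw [e1, e2]
      set a := (g + h) ^ (2 * m)
      set b := (g - h) ^ (2 * m)
      have hs : 0 ≤ g ^ 2 + h ^ 2 := by positivity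
      have hh : 0 ≤ h ^ 2 * X := by positivity
      constructor
      · calc _ = (g ^ 2 + h ^ 2) * ((a + b) / 2) + g * h * (a - b) := by ring
          _ ≤ (g ^ 2 + h ^ 2) * X + 4 * m * h ^ 2 * X := by gcongr
          _ = (g ^ 2 + (4 * m + 1) * h ^ 2) * X := by ring
          _ ≤ (g ^ 2 + q * h ^ 2) * X := by gcongr; linarith
          _ = _ := by rw [pow_succ]; ring
      · calc _ = (g ^ 2 + h ^ 2) * (g * h * (a - b)) + 4 * (g ^ 2 * h ^ 2) * ((a + b) / 2) := by
              ring
          _ ≤ (g ^ 2 + h ^ 2) * (4 * m * h ^ 2 * X) + 4 * (g ^ 2 * h ^ 2) * X := by gcongr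
          _ = h ^ 2 * X * (4 * (m + 1) * g ^ 2 + 4 * m * h ^ 2) := by ring
          _ ≤ h ^ 2 * X * (4 * (m + 1) * g ^ 2 + 4 * (m + 1) * (q * h ^ 2)) := by
              gcongr
              · linarith
              · exact le_mul_of_one_le_left (by positivity) (by linarith [(Nat.cast_nonneg m : (0:ℝ) ≤ m)])
          _ = _ := by rw [pow_succ (g ^ 2 + q * h ^ 2) m, ← hX]; push_cast; ring
  exact (key p le_rfl).1

/-- Minkowski's inequality in `ℓᵖ`, freed of its roots. -/
theorem sum_add_pow_le_of_sum_pow_le {Ω : Type*} [Fintype Ω] {u v : Ω → ℝ} {A B N : ℝ} {p : ℕ}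
    (hp : p ≠ 0) (hu : ∀ x, 0 ≤ u x) (hv : ∀ x, 0 ≤ v x) (hA : 0 ≤ A) (hB : 0 ≤ B) (hN : 0 ≤ N)
    (huA : ∑ x, u x ^ p ≤ N * A ^ p) (hvB : ∑ x, v x ^ p ≤ N * B ^ p) :
    ∑ x, (u x + v x) ^ p ≤ N * (A + B) ^ p := by
  have hp1 : (1 : ℝ) ≤ p := by exact_mod_cast Nat.one_le_iff_ne_zero.2 hp
  have h := Real.Lp_add_le_of_nonneg (f := u) (g := v) Finset.univ hp1 (fun i _ => hu i)
    (fun i _ => hv i)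
  simp only [Real.rpow_natCast] at h
  have root : ∀ {D : ℝ}, 0 ≤ D → (N * D ^ p) ^ (1 / (p : ℝ)) = N ^ (1 / (p : ℝ)) * D := by
    intro D hD
    rw [Real.mul_rpow hN (by positivity), one_div, Real.pow_rpow_inv_natCast hD hp]
  have h1 : (∑ x, u x ^ p) ^ (1 / (p : ℝ)) ≤ N ^ (1 / (p : ℝ)) * A := by
    rw [← root hA]
    exact Real.rpow_le_rpow (Finset.sum_nonneg fun i _ => pow_nonneg (hu i) p) huA (by positivity)
  have h2 : (∑ x, v x ^ p) ^ (1 / (p : ℝ)) ≤ N ^ (1 / (p : ℝ)) * B := by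
    rw [← root hB]
    exact Real.rpow_le_rpow (Finset.sum_nonneg fun i _ => pow_nonneg (hv i) p) hvB (by positivity)
  have h3 : (∑ x, (u x + v x) ^ p) ^ (1 / (p : ℝ)) ≤ (N * (A + B) ^ p) ^ (1 / (p : ℝ)) := by
    rw [root (by positivity)]; linarith
  exact (Real.rpow_le_rpow_iff
    (Finset.sum_nonneg fun i _ => pow_nonneg (add_nonneg (hu i) (hv i)) p) (by positivity)
    (by positivity)).1 h3

/-- The number `±1` attached to the `j`-th coordinate of a sign vector. -/
def signCoord {ι : Type*} (e : ι → ℤˣ) (j : ι) : ℝ := ((e j : ℤ) : ℝ)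

theorem signCoord_sq {ι : Type*} (e : ι → ℤˣ) (j : ι) : signCoord e j ^ 2 = 1 := by
  rcases Int.units_eq_one_or (e j) with h | h <;> simp [signCoord, h]

theorem signCoord_mulSingle_same {ι : Type*} [DecidableEq ι] (e : ι → ℤˣ) (j : ι) :
    signCoord (Pi.mulSingle j (-1) * e) j = - signCoord e j := by
  simp [signCoord]

theorem signCoord_mulSingle_of_ne {ι : Type*} [DecidableEq ι] (e : ι → ℤˣ) {j l : ι} (h : l ≠ j) :
    signCoord (Pi.mulSingle j (-1) * e) l = signCoord e l := by
  simp [signCoord, h]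

section Chaos

variable {ι : Type*} [Fintype ι] [DecidableEq ι]

/-- The induction step for the chaos bounds: averaging over the flip of sign `j` reduces to the
two-point inequality, and Minkowski then separates the two parts. -/
theorem sum_sign_pow_le {g h : (ι → ℤˣ) → ℝ} {j : ι} {p : ℕ} {q A B : ℝ} (hp : p ≠ 0)
    (hq : (4 * p : ℝ) ≤ q)
    (hg : ∀ e, g (Pi.mulSingle j (-1) * e) = g e) (hh : ∀ e, h (Pi.mulSingle j (-1) * e) = h e)
    (hA : 0 ≤ A) (hB : 0 ≤ B)
    (hgA : ∑ e, g e ^ (2 * p) ≤ Fintype.card (ι → ℤˣ) * A ^ p)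
    (hhB : ∑ e, h e ^ (2 * p) ≤ Fintype.card (ι → ℤˣ) * B ^ p) :
    ∑ e, (g e + signCoord e j * h e) ^ (2 * p) ≤ Fintype.card (ι → ℤˣ) * (A + q * B) ^ p := by
  have hq0 : 0 ≤ q := le_trans (by positivity) hq
  have hflip : ∑ e, (g e - signCoord e j * h e) ^ (2 * p)
      = ∑ e, (g e + signCoord e j * h e) ^ (2 * p) := by
    rw [← Equiv.sum_comp (Equiv.mulLeft (Pi.mulSingle j (-1) : ι → ℤˣ))]
    refine Finset.sum_congr rfl fun e _ => ?_
    simp [hg, hh, signCoord_mulSingle_same]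
  calc ∑ e, (g e + signCoord e j * h e) ^ (2 * p)
      = ∑ e, ((g e + signCoord e j * h e) ^ (2 * p)
          + (g e - signCoord e j * h e) ^ (2 * p)) / 2 := by
        rw [← Finset.sum_div, Finset.sum_add_distrib, hflip]; ring
    _ ≤ ∑ e, (g e ^ 2 + q * h e ^ 2) ^ p := by
        refine Finset.sum_le_sum fun e _ => ?_
        refine (twoPoint_pow_le _ _ q p hq).trans_eq ?_
        rw [mul_pow, signCoord_sq, one_mul]
    _ ≤ _ := by
        refine sum_add_pow_le_of_sum_pow_le hp (fun e => sq_nonneg _) (fun e => by positivity) hA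
          (by positivity) (by positivity) ?_ ?_
        · simpa only [← pow_mul] using hgA
        · simp only [mul_pow, ← pow_mul, ← Finset.mul_sum]
          calc _ ≤ q ^ p * (Fintype.card (ι → ℤˣ) * B ^ p) := by gcongr
            _ = _ := by ring

theorem sum_sign_linear_pow_le (b : ι → ℝ) (s : Finset ι) {p : ℕ} (hp : p ≠ 0) {q : ℝ}
    (hq : (4 * p : ℝ) ≤ q) :
    ∑ e : ι → ℤˣ, (∑ j ∈ s, b j * signCoord e j) ^ (2 * p)
      ≤ Fintype.card (ι → ℤˣ) * (q * ∑ j ∈ s, b j ^ 2) ^ p := by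
  have hq0 : 0 ≤ q := le_trans (by positivity) hq
  induction s using Finset.induction_on with
  | empty => simp [hp]
  | insert j s hj ih =>
    have h := sum_sign_pow_le (g := fun e => ∑ l ∈ s, b l * signCoord e l) (h := fun _ => b j)
      (j := j) hp hq (fun e => Finset.sum_congr rfl fun l hl => by
        rw [signCoord_mulSingle_of_ne e (ne_of_mem_of_not_mem hl hj)]) (fun e => rfl)
      (by positivity) (sq_nonneg (b j)) ih (by simp [← pow_mul])
    calc _ = _ := Finset.sum_congr rfl fun e _ => by
              rw [Finset.sum_insert hj, add_comm, mul_comm (b j)]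
      _ ≤ _ := h
      _ = _ := by rw [Finset.sum_insert hj]; ring

/-- A new index `j` contributes its sign times the linear form with coefficients `2 * M j l`, which
costs `4 * q ^ 2 * ∑ M j l ^ 2`. By symmetry this is `2 * q ^ 2` times the new row and column
together. -/
theorem sum_sign_quadratic_pow_le (M : ι → ι → ℝ) (hM : ∀ j l, M j l = M l j) (s : Finset ι)
    {p : ℕ} (hp : p ≠ 0) {q : ℝ} (hq : (4 * p : ℝ) ≤ q) :
    ∑ e : ι → ℤˣ,
        (∑ j ∈ s, ∑ l ∈ s, (if j = l then 0 else M j l) * (signCoord e j * signCoord e l)) ^ (2 * p)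
      ≤ Fintype.card (ι → ℤˣ) * (2 * q ^ 2 * ∑ j ∈ s, ∑ l ∈ s, M j l ^ 2) ^ p := by
  have hq0 : 0 ≤ q := le_trans (by positivity) hq
  induction s using Finset.induction_on with
  | empty => simp [hp]
  | insert j s hj ih =>
    have hne : ∀ l ∈ s, l ≠ j := fun l hl => ne_of_mem_of_not_mem hl hj
    have h := sum_sign_pow_le
      (g := fun e => ∑ i ∈ s, ∑ l ∈ s, (if i = l then 0 else M i l) *
        (signCoord e i * signCoord e l))
      (h := fun e => ∑ l ∈ s, (2 * M j l) * signCoord e l)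
      (j := j) hp hq
      (fun e => Finset.sum_congr rfl fun i hi => Finset.sum_congr rfl fun l hl => by
        rw [signCoord_mulSingle_of_ne e (hne l hl), signCoord_mulSingle_of_ne e (hne i hi)])
      (fun e => Finset.sum_congr rfl fun l hl => by
        rw [signCoord_mulSingle_of_ne e (hne l hl)])
      (by positivity) (by positivity) ih
      (sum_sign_linear_pow_le (fun l => 2 * M j l) s hp hq)
    have hexp : ∀ e : ι → ℤˣ, ∑ i ∈ insert j s, ∑ l ∈ insert j s,
          (if i = l then 0 else M i l) * (signCoord e i * signCoord e l)
        = ∑ i ∈ s, ∑ l ∈ s, (if i = l then 0 else M i l) * (signCoord e i * signCoord e l)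
          + signCoord e j * ∑ l ∈ s, (2 * M j l) * signCoord e l := by
      intro e
      simp only [Finset.sum_insert hj, Finset.sum_add_distrib, if_true, zero_mul, zero_add]
      have e1 : ∑ l ∈ s, (if j = l then 0 else M j l) * (signCoord e j * signCoord e l)
          = ∑ l ∈ s, M j l * (signCoord e j * signCoord e l) :=
        Finset.sum_congr rfl fun l hl => by rw [if_neg (hne l hl).symm]
      have e2 : ∑ l ∈ s, (if l = j then 0 else M l j) * (signCoord e l * signCoord e j)
          = ∑ l ∈ s, M j l * (signCoord e j * signCoord e l) :=
        Finset.sum_congr rfl fun l hl => by rw [if_neg (hne l hl), hM, mul_comm (signCoord e l)]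
      rw [e1, e2, ← add_assoc, ← Finset.sum_add_distrib, add_comm, Finset.mul_sum]
      congr 1
      exact Finset.sum_congr rfl fun l _ => by ring
    have hcol : ∑ l ∈ s, M l j ^ 2 = ∑ l ∈ s, M j l ^ 2 :=
      Finset.sum_congr rfl fun l _ => by rw [hM]
    simp only [hexp]
    refine h.trans ?_
    have hlhs : 0 ≤ ∑ i ∈ s, ∑ l ∈ s, M i l ^ 2 := by positivity
    gcongr ?_ * (?_) ^ p
    simp only [Finset.sum_insert hj, Finset.sum_add_distrib, hcol, mul_pow, ← Finset.mul_sum]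
    nlinarith [mul_nonneg (sq_nonneg q) (sq_nonneg (M j j))]

end Chaos

/-! ### Averaging over the rows of a Haar-random orthogonal matrix. -/

section Haar
open Matrix
variable {d : ℕ}

instance compactSpace_orthogonalGroup : CompactSpace (Matrix.orthogonalGroup (Fin d) ℝ) := by
  refine isCompact_iff_compactSpace.1 (?_ : IsCompact (Matrix.orthogonalGroup (Fin d) ℝ :
    Set (Matrix (Fin d) (Fin d) ℝ)))
  have hclosed : IsClosed ((Matrix.orthogonalGroup (Fin d) ℝ : Set (Matrix (Fin d) (Fin d) ℝ))) := by
    have : (Matrix.orthogonalGroup (Fin d) ℝ : Set (Matrix (Fin d) (Fin d) ℝ))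
        = {A | A * A.transpose = 1} := by
      ext A; exact Matrix.mem_orthogonalGroup_iff (Fin d) ℝ
    rw [this]
    exact isClosed_eq (by fun_prop) continuous_const
  have hsub : (Matrix.orthogonalGroup (Fin d) ℝ : Set (Matrix (Fin d) (Fin d) ℝ))
      ⊆ Set.pi Set.univ fun _ : Fin d => Set.pi Set.univ fun _ : Fin d => Set.Icc (-1 : ℝ) 1 := by
    intro A hA i _ j _
    have h := (Matrix.mem_orthogonalGroup_iff (Fin d) ℝ).1 hA
    have h1 : ∑ l, A i l * A i l = 1 := by
      simpa [Matrix.mul_apply] using congrFun (congrFun h i) i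
    have h2 : A i j * A i j ≤ 1 := by
      rw [← h1]
      exact Finset.single_le_sum (f := fun l => A i l * A i l)
        (fun l _ => mul_self_nonneg _) (Finset.mem_univ j)
    exact abs_le.1 (abs_le_one_iff_mul_self_le_one.2 h2)
  exact (isCompact_univ_pi fun _ => isCompact_univ_pi fun _ => isCompact_Icc).of_isClosed_subset
    hclosed hsub

/-- The Householder reflection along `x - y` exchanges `x` and `y`. -/
theorem exists_orthogonalGroup_vecMul_eq {x y : Fin d → ℝ} (h : x ⬝ᵥ x = y ⬝ᵥ y) :
    ∃ V : Matrix.orthogonalGroup (Fin d) ℝ, x ᵥ* (V : Matrix (Fin d) (Fin d) ℝ) = y := by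
  rcases eq_or_ne x y with rfl | hxy
  · exact ⟨1, by simp⟩
  set z := x - y with hz
  have hz0 : z ⬝ᵥ z ≠ 0 := by
    rw [Ne, dotProduct_self_eq_zero]; exact sub_ne_zero.2 hxy
  have hzz : z ⬝ᵥ z = 2 * (x ⬝ᵥ z) := by
    simp only [hz, sub_dotProduct, dotProduct_sub, dotProduct_comm y x]; linarith
  set H : Matrix (Fin d) (Fin d) ℝ := 1 - (2 / (z ⬝ᵥ z)) • vecMulVec z z with hH
  have hT : Hᵀ = H := by
    simp [hH, transpose_vecMulVec]
  have hmul : vecMulVec z z * vecMulVec z z = (z ⬝ᵥ z) • vecMulVec z z := by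
    rw [vecMulVec_mul_vecMulVec]
    ext i j; simp [vecMulVec_apply]; ring
  refine ⟨⟨H, (Matrix.mem_orthogonalGroup_iff (Fin d) ℝ).2 ?_⟩, ?_⟩
  · rw [hT, hH, sub_mul, mul_sub, mul_sub, smul_mul_smul_comm, hmul, smul_smul]
    simp only [mul_one, one_mul]
    rw [show 2 / (z ⬝ᵥ z) * (2 / (z ⬝ᵥ z)) * (z ⬝ᵥ z) = 2 / (z ⬝ᵥ z) + 2 / (z ⬝ᵥ z) by
      field_simp; norm_num, add_smul]
    abel
  · show x ᵥ* H = y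
    rw [hH, vecMul_sub, vecMul_one, vecMul_smul, vecMul_vecMulVec, smul_smul]
    have : 2 / (z ⬝ᵥ z) * (x ⬝ᵥ z) = 1 := by
      rw [hzz] at hz0 ⊢
      have := right_ne_zero_of_mul hz0
      field_simp
    rw [this, one_smul, hz]; simp

/-- Since Haar measure is left invariant and the group is transitive on the unit sphere, `x ᵥ* U`
has the same law for every unit vector `x`. Each row may thus be replaced by an average over
normalized sign vectors, and some `U` does no worse than the mean. -/
theorem exists_orthogonalGroup_sum_row_le (hd : 0 < d) {F : (Fin d → ℝ) → ℝ} (hF : Continuous F)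
    {B : ℝ}
    (hB : ∀ U : Matrix.orthogonalGroup (Fin d) ℝ,
      ∑ e : Fin d → ℤˣ, F ((fun j => signCoord e j / √d) ᵥ* (U : Matrix (Fin d) (Fin d) ℝ))
        ≤ Fintype.card (Fin d → ℤˣ) * B) :
    ∃ U : Matrix.orthogonalGroup (Fin d) ℝ, ∑ k, F ((U : Matrix (Fin d) (Fin d) ℝ) k) ≤ d * B := by
  let _ : MeasurableSpace (Matrix.orthogonalGroup (Fin d) ℝ) := borel _
  have _ : BorelSpace (Matrix.orthogonalGroup (Fin d) ℝ) := ⟨rfl⟩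
  let μ : Measure (Matrix.orthogonalGroup (Fin d) ℝ) := Measure.haarMeasure ⊤
  have hμ : IsProbabilityMeasure μ := ⟨by
    have := Measure.haarMeasure_self
      (K₀ := (⊤ : TopologicalSpace.PositiveCompacts (Matrix.orthogonalGroup (Fin d) ℝ)))
    simpa using this⟩
  have hcont : ∀ x : Fin d → ℝ, Continuous fun U : Matrix.orthogonalGroup (Fin d) ℝ =>
      F (x ᵥ* (U : Matrix (Fin d) (Fin d) ℝ)) := fun x => by fun_prop
  have hint : ∀ x : Fin d → ℝ, Integrable (fun U : Matrix.orthogonalGroup (Fin d) ℝ =>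
      F (x ᵥ* (U : Matrix (Fin d) (Fin d) ℝ))) μ := fun x =>
    (hcont x).integrable_of_hasCompactSupport (HasCompactSupport.of_compactSpace _)
  have hinv : ∀ x y : Fin d → ℝ, x ⬝ᵥ x = y ⬝ᵥ y →
      ∫ U, F (x ᵥ* (U : Matrix (Fin d) (Fin d) ℝ)) ∂μ
        = ∫ U, F (y ᵥ* (U : Matrix (Fin d) (Fin d) ℝ)) ∂μ := by
    intro x y hxy
    obtain ⟨V, rfl⟩ := exists_orthogonalGroup_vecMul_eq hxy
    rw [← integral_mul_left_eq_self (fun U : Matrix.orthogonalGroup (Fin d) ℝ =>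
      F (x ᵥ* (U : Matrix (Fin d) (Fin d) ℝ))) V]
    simp [vecMul_vecMul]
  have hnorm : ∀ e : Fin d → ℤˣ,
      (fun j => signCoord e j / √d) ⬝ᵥ (fun j => signCoord e j / √d) = 1 := by
    intro e
    have : ∀ j, signCoord e j / √d * (signCoord e j / √d) = 1 / d := fun j => by
      rw [div_mul_div_comm, ← sq, signCoord_sq, Real.mul_self_sqrt (by positivity)]
    simp only [dotProduct, this, Finset.sum_const, Finset.card_univ, Fintype.card_fin,
      nsmul_eq_mul]
    field_simp
  have hN : (0 : ℝ) < Fintype.card (Fin d → ℤˣ) := by exact_mod_cast Fintype.card_pos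
  have hrow : ∀ k, ∫ U, F ((U : Matrix (Fin d) (Fin d) ℝ) k) ∂μ ≤ B := by
    intro k
    have hk : ∀ e : Fin d → ℤˣ, ∫ U, F ((U : Matrix (Fin d) (Fin d) ℝ) k) ∂μ
        = ∫ U, F ((fun j => signCoord e j / √d) ᵥ* (U : Matrix (Fin d) (Fin d) ℝ)) ∂μ := by
      intro e
      rw [← hinv (Pi.single k 1) _ (by rw [hnorm e]; simp)]
      simp [Matrix.row]
    have hsum : (Fintype.card (Fin d → ℤˣ) : ℝ) * ∫ U, F ((U : Matrix (Fin d) (Fin d) ℝ) k) ∂μ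
        = ∫ U, ∑ e : Fin d → ℤˣ,
            F ((fun j => signCoord e j / √d) ᵥ* (U : Matrix (Fin d) (Fin d) ℝ)) ∂μ := by
      rw [integral_finsetSum _ fun e _ => hint _, ← Finset.sum_congr rfl fun e _ => hk e]
      simp
    have hle : ∫ U, ∑ e : Fin d → ℤˣ,
            F ((fun j => signCoord e j / √d) ᵥ* (U : Matrix (Fin d) (Fin d) ℝ)) ∂μ
        ≤ Fintype.card (Fin d → ℤˣ) * B := by
      refine (integral_mono (integrable_finsetSum _ fun e _ => hint _) (integrable_const _)
        hB).trans_eq ?_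
      simp
    rw [← hsum] at hle
    exact le_of_mul_le_mul_left hle hN
  have hintk : ∀ k, Integrable (fun U : Matrix.orthogonalGroup (Fin d) ℝ =>
      F ((U : Matrix (Fin d) (Fin d) ℝ) k)) μ := fun k => by
    simpa [Matrix.row] using hint (Pi.single k 1)
  obtain ⟨U, hU⟩ := exists_le_integral (μ := μ) (integrable_finsetSum Finset.univ
    fun k _ => hintk k)
  refine ⟨U, hU.trans ?_⟩
  rw [integral_finsetSum _ fun k _ => hintk k]
  exact (Finset.sum_le_sum fun k _ => hrow k).trans_eq (by simp)

end Haar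

/-! ### Equidistribution in a space with constant diagonal kernel. -/

section Mass

variable {G : Type*} [Fintype G] {d : ℕ}

/-- Bessel's inequality for each `u l` cut off to `A`, summed over `l`. -/
theorem sum_sq_restricted_gram_le {u : Fin d → EuclideanSpace ℝ G} (hu : Orthonormal ℝ u)
    {κ : ℝ} (hdiag : ∀ g, ∑ j, u j g ^ 2 = κ) (A : Finset G) :
    ∑ j, ∑ l, (∑ g ∈ A, u j g * u l g) ^ 2 ≤ A.card * κ := by
  classical
  have hrow : ∀ l, ∑ j, (∑ g ∈ A, u j g * u l g) ^ 2 ≤ ∑ g ∈ A, u l g ^ 2 := by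
    intro l
    have h := hu.sum_inner_products_le (s := Finset.univ)
      (WithLp.toLp 2 fun g => if g ∈ A then u l g else 0)
    rw [EuclideanSpace.norm_sq_eq] at h
    convert h using 1
    · refine Finset.sum_congr rfl fun j _ => ?_
      rw [Real.norm_eq_abs, sq_abs]
      simp [PiLp.inner_apply, Finset.sum_ite_mem, mul_comm]
    · simp [apply_ite, ite_pow, Finset.sum_ite_mem]
  rw [Finset.sum_comm]
  calc _ ≤ ∑ l, ∑ g ∈ A, u l g ^ 2 := Finset.sum_le_sum fun l _ => hrow l
    _ = ∑ g ∈ A, ∑ l, u l g ^ 2 := Finset.sum_comm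
    _ = _ := by simp [hdiag]

theorem sum_sign_mass_pow_le (hd : 0 < d) {u : Fin d → EuclideanSpace ℝ G} (hu : Orthonormal ℝ u)
    {n : ℝ} (hn : 0 < n) (hdiag : ∀ g, ∑ j, u j g ^ 2 = d / n) (A : Finset G) {p : ℕ}
    (hp : p ≠ 0) {q : ℝ} (hq : (4 * p : ℝ) ≤ q) :
    ∑ e : Fin d → ℤˣ, (∑ g ∈ A, (∑ j, signCoord e j / √d * u j g) ^ 2 - A.card / n) ^ (2 * p)
      ≤ Fintype.card (Fin d → ℤˣ) * (2 * q ^ 2 * (A.card / n / d)) ^ p := by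
  have hq0 : 0 ≤ q := le_trans (by positivity) hq
  have hd0 : (0 : ℝ) < d := by exact_mod_cast hd
  set M : Fin d → Fin d → ℝ := fun j l => (∑ g ∈ A, u j g * u l g) / d with hM
  have hexp : ∀ e : Fin d → ℤˣ,
      ∑ g ∈ A, (∑ j, signCoord e j / √d * u j g) ^ 2 - A.card / n
        = ∑ j, ∑ l, (if j = l then 0 else M j l) * (signCoord e j * signCoord e l) := by
    intro e
    have h1 : ∑ g ∈ A, (∑ j, signCoord e j / √d * u j g) ^ 2
        = ∑ j, ∑ l, M j l * (signCoord e j * signCoord e l) := by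
      simp only [sq, Finset.sum_mul_sum]
      simp only [hM, Finset.sum_div, Finset.sum_mul]
      rw [Finset.sum_comm]
      refine Finset.sum_congr rfl fun j _ => ?_
      rw [Finset.sum_comm]
      refine Finset.sum_congr rfl fun l _ => Finset.sum_congr rfl fun g _ => ?_
      have : √(d : ℝ) * √(d : ℝ) = d := Real.mul_self_sqrt hd0.le
      calc _ = u j g * u l g / (√(d : ℝ) * √(d : ℝ)) * (signCoord e j * signCoord e l) := by
            field_simp
        _ = _ := by rw [this]
    -- Squared signs are `1`, so subtracting the mean removes exactly the diagonal of the quadratic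
    -- form.
    have h2 : ∑ j, M j j = A.card / n := by
      simp only [hM, ← Finset.sum_div, ← sq]
      rw [Finset.sum_comm]
      simp only [hdiag, Finset.sum_const, nsmul_eq_mul]
      field_simp
    have h3 : ∑ j, M j j = ∑ j, ∑ l, (if j = l then M j l else 0) *
        (signCoord e j * signCoord e l) := by
      refine Finset.sum_congr rfl fun j _ => ?_
      simp [← sq, signCoord_sq]
    rw [h1, ← h2, h3, ← Finset.sum_sub_distrib]
    refine Finset.sum_congr rfl fun j _ => ?_
    rw [← Finset.sum_sub_distrib]
    refine Finset.sum_congr rfl fun l _ => ?_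
    split_ifs <;> ring
  simp only [hexp]
  refine (sum_sign_quadratic_pow_le M (fun j l => by simp [hM, mul_comm]) Finset.univ hp hq).trans ?_
  have hfrob : ∑ j, ∑ l, M j l ^ 2 ≤ A.card / n / d := by
    have h := sum_sq_restricted_gram_le hu hdiag A
    simp only [hM, div_pow, ← Finset.sum_div]
    calc _ ≤ (A.card * (d / n)) / (d : ℝ) ^ 2 := by gcongr
      _ = _ := by field_simp
  have : 0 ≤ ∑ j, ∑ l, M j l ^ 2 := by positivity
  gcongr

theorem sum_sq_rotated_eq {α : Type*} (c : Fin d → α → ℝ)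
    (U : Matrix.orthogonalGroup (Fin d) ℝ) (g : α) :
    ∑ j, (∑ i, (U : Matrix (Fin d) (Fin d) ℝ) j i * c i g) ^ 2 = ∑ i, c i g ^ 2 := by
  have hU := (Matrix.mem_orthogonalGroup_iff' (Fin d) ℝ).1 U.2
  have hUe : ∀ i l, ∑ j, (U : Matrix (Fin d) (Fin d) ℝ) j i * (U : Matrix (Fin d) (Fin d) ℝ) j l
      = if i = l then 1 else 0 := fun i l => by
    simpa [Matrix.mul_apply, Matrix.one_apply] using congrFun (congrFun hU i) l
  calc _ = ∑ j, ∑ i, ∑ l, ((U : Matrix (Fin d) (Fin d) ℝ) j i *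
          (U : Matrix (Fin d) (Fin d) ℝ) j l) * (c i g * c l g) := by
        refine Finset.sum_congr rfl fun j _ => ?_
        rw [sq, Finset.sum_mul_sum]
        exact Finset.sum_congr rfl fun i _ => Finset.sum_congr rfl fun l _ => by ring
    _ = ∑ i, ∑ l, (∑ j, (U : Matrix (Fin d) (Fin d) ℝ) j i *
          (U : Matrix (Fin d) (Fin d) ℝ) j l) * (c i g * c l g) := by
        simp only [Finset.sum_mul]
        rw [Finset.sum_comm]
        exact Finset.sum_congr rfl fun i _ => Finset.sum_comm
    _ = _ := by simp [hUe, sq]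

theorem orthonormal_rotated {E : Type*} [NormedAddCommGroup E] [InnerProductSpace ℝ E]
    {e : Fin d → E} (he : Orthonormal ℝ e) (U : Matrix.orthogonalGroup (Fin d) ℝ) :
    Orthonormal ℝ fun j => ∑ i, (U : Matrix (Fin d) (Fin d) ℝ) j i • e i := by
  have hU := (Matrix.mem_orthogonalGroup_iff (Fin d) ℝ).1 U.2
  rw [orthonormal_iff_ite] at he ⊢
  intro j k
  have h : ∑ i, (U : Matrix (Fin d) (Fin d) ℝ) j i * (U : Matrix (Fin d) (Fin d) ℝ) k i
      = if j = k then 1 else 0 := by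
    simpa [Matrix.mul_apply, Matrix.one_apply] using congrFun (congrFun hU j) k
  rw [← h]
  simp [sum_inner, inner_sum, inner_smul_left, inner_smul_right, he, mul_comm]

/-- A subspace all of whose orthonormal bases have constant diagonal kernel has an orthonormal basis
that is equidistributed on finitely many sets, provided a union bound over moments applies. -/
theorem exists_orthonormalBasis_equidistributed {W : Submodule ℝ (EuclideanSpace ℝ G)}
    (e : OrthonormalBasis (Fin d) ℝ W) (hd : 0 < d) {n : ℝ} (hn : 0 < n)
    (hdiag : ∀ g, ∑ j, (e j : EuclideanSpace ℝ G) g ^ 2 = d / n)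
    {κ : Type*} [Fintype κ] (A : κ → Finset G) (t : κ → ℝ) (ht : ∀ i, 0 < t i) {p : ℕ}
    (hp : p ≠ 0)
    (hsmall : (d : ℝ) * ∑ i, (2 * (4 * p : ℝ) ^ 2 * ((A i).card / n / d) / t i ^ 2) ^ p < 1) :
    ∃ b : OrthonormalBasis (Fin d) ℝ W, ∀ k i,
      |∑ g ∈ A i, (b k : EuclideanSpace ℝ G) g ^ 2 - (A i).card / n| ≤ t i := by
  set F : (Fin d → ℝ) → ℝ := fun x =>
    ∑ i, ((∑ g ∈ A i, (∑ l, x l * (e l : EuclideanSpace ℝ G) g) ^ 2 - (A i).card / n) / t i)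
      ^ (2 * p) with hF
  have hFc : Continuous F := by simp only [hF]; fun_prop
  obtain ⟨U, hU⟩ := exists_orthogonalGroup_sum_row_le hd hFc
    (B := ∑ i, (2 * (4 * p : ℝ) ^ 2 * ((A i).card / n / d) / t i ^ 2) ^ p) (by
      intro U
      set u : Fin d → EuclideanSpace ℝ G := fun j =>
        ∑ i, (U : Matrix (Fin d) (Fin d) ℝ) j i • (e i : EuclideanSpace ℝ G) with hu
      have huo : Orthonormal ℝ u := orthonormal_rotated
        (e.orthonormal.comp_linearIsometry W.subtypeₗᵢ) U
      have hug : ∀ j g, u j g = ∑ i, (U : Matrix (Fin d) (Fin d) ℝ) j i *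
          (e i : EuclideanSpace ℝ G) g := fun j g => by simp [hu]
      have hudiag : ∀ g, ∑ j, u j g ^ 2 = d / n := fun g => by
        simp only [hug]
        rw [sum_sq_rotated_eq (fun i g => (e i : EuclideanSpace ℝ G) g) U g, hdiag]
      have hsub : ∀ (s : Fin d → ℤˣ) (g : G),
          ∑ l, (Matrix.vecMul (fun j => signCoord s j / √d) (U : Matrix (Fin d) (Fin d) ℝ)) l *
            (e l : EuclideanSpace ℝ G) g = ∑ j, signCoord s j / √d * u j g := by
        intro s g
        simp only [hug, Matrix.vecMul, dotProduct, Finset.sum_mul, Finset.mul_sum]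
        rw [Finset.sum_comm]
        exact Finset.sum_congr rfl fun j _ => Finset.sum_congr rfl fun l _ => by ring
      simp only [hF, hsub]
      rw [Finset.sum_comm, Finset.mul_sum]
      refine Finset.sum_le_sum fun i _ => ?_
      simp only [div_pow _ (t i)]
      rw [← Finset.sum_div, div_pow, mul_div_assoc', ← pow_mul]
      have := ht i
      gcongr
      exact sum_sign_mass_pow_le hd huo hn hudiag (A i) hp le_rfl)
  have hb := orthonormal_rotated e.orthonormal U
  let b : OrthonormalBasis (Fin d) ℝ W := OrthonormalBasis.mk hb (by
    have hc : Fintype.card (Fin d) = Module.finrank ℝ W := by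
      rw [Module.finrank_eq_card_basis e.toBasis]
    exact (hb.linearIndependent.span_eq_top_of_card_eq_finrank' hc).ge)
  refine ⟨b, fun k i => ?_⟩
  have hbk : ∀ g, (b k : EuclideanSpace ℝ G) g
      = ∑ l, (U : Matrix (Fin d) (Fin d) ℝ) k l * (e l : EuclideanSpace ℝ G) g := fun g => by
    simp [b]
  have hlt := hU.trans_lt hsmall
  -- Union bound: a sum of even powers below `1` forces every single term below `1`.
  have h1 : ((∑ g ∈ A i, (b k : EuclideanSpace ℝ G) g ^ 2 - (A i).card / n) / t i) ^ (2 * p) < 1 := by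
    refine lt_of_le_of_lt ?_ hlt
    have hpos : ∀ (x : Fin d → ℝ) i, 0 ≤ ((∑ g ∈ A i, (∑ l, x l * (e l : EuclideanSpace ℝ G) g) ^ 2
        - (A i).card / n) / t i) ^ (2 * p) := fun x i => (even_two_mul p).pow_nonneg _
    refine le_trans ?_ (Finset.single_le_sum (f := fun k => F ((U : Matrix (Fin d) (Fin d) ℝ) k))
      (fun k _ => Finset.sum_nonneg fun i _ => hpos _ i) (Finset.mem_univ k))
    refine le_trans ?_ (Finset.single_le_sum (fun i _ => hpos _ i) (Finset.mem_univ i))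
    simp only [hbk]; exact le_rfl
  have h2 : |(∑ g ∈ A i, (b k : EuclideanSpace ℝ G) g ^ 2 - (A i).card / n) / t i| < 1 := by
    rw [← (even_two_mul p).pow_abs] at h1
    exact (pow_lt_one_iff_of_nonneg (abs_nonneg _) (by positivity)).1 h1
  rw [abs_div, abs_of_pos (ht i), div_lt_one (ht i)] at h2
  exact h2.le

end Mass

/-! ### Left-invariant spaces: dimension and diagonal kernel. -/

section LeftInvariant

/-- A minimal nonzero invariant subspace is irreducible. A trivial action would make its functions
constant, and a constant with zero sum vanishes. -/
theorem quasirandomDegree_le_finrank {G : Type*} [Group G] [Fintype G]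
    {V : Submodule ℂ (G → ℂ)} (hV : V ≠ ⊥)
    (hinv : ∀ h : G, ∀ f ∈ V, (fun g => f (h⁻¹ * g)) ∈ V) (hsum : ∀ f ∈ V, ∑ g, f g = 0) :
    quasirandomDegree G ≤ Module.finrank ℂ V := by
  obtain ⟨V₀, ⟨hV₀V, hV₀, hinv₀⟩, hmin⟩ := wellFounded_lt.has_min
    {V' : Submodule ℂ (G → ℂ) | V' ≤ V ∧ V' ≠ ⊥ ∧
      ∀ h : G, ∀ f ∈ V', (fun g => f (h⁻¹ * g)) ∈ V'} ⟨V, le_rfl, hV, hinv⟩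
  let L : G → V₀ →ₗ[ℂ] V₀ := fun h =>
    { toFun := fun f => ⟨fun g => f.1 (h⁻¹ * g), hinv₀ h f.1 f.2⟩
      map_add' := fun _ _ => rfl
      map_smul' := fun _ _ => rfl }
  let φ : V₀ ≃ₗ[ℂ] (Fin (Module.finrank ℂ V₀) → ℂ) := (Module.finBasis ℂ V₀).equivFun
  let ρ : Representation ℂ G (Fin (Module.finrank ℂ V₀) → ℂ) :=
    { toFun := fun h => φ.toLinearMap ∘ₗ L h ∘ₗ φ.symm.toLinearMap
      map_one' := by
        ext1 x
        ext1
        apply φ.symm.injective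
        ext g
        simp [L]
      map_mul' := fun a b => by
        ext1 x
        ext1
        apply φ.symm.injective
        ext g
        simp [L, mul_assoc] }
  let ψ : (Fin (Module.finrank ℂ V₀) → ℂ) →ₗ[ℂ] (G → ℂ) := V₀.subtype ∘ₗ φ.symm.toLinearMap
  have hψinj : Function.Injective ψ := V₀.injective_subtype.comp φ.symm.injective
  have hψρ : ∀ h x, ψ (ρ h x) = fun g => ψ x (h⁻¹ * g) := by
    intro h x
    ext g
    simp [ψ, ρ, L]
  have hψV : ∀ x, ψ x ∈ V₀ := fun x => (φ.symm x).2
  obtain ⟨f₀, hf₀, hf₀0⟩ := V₀.ne_bot_iff.1 hV₀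
  have hφf₀ : φ ⟨f₀, hf₀⟩ ≠ 0 := by
    intro h
    exact hf₀0 (congrArg Subtype.val (φ.map_eq_zero_iff.1 h))
  have hirr : ρ.IsIrreducible := by
    have : Nontrivial (Subrepresentation ρ) := by
      refine ⟨⊥, ⊤, fun h => hφf₀ ?_⟩
      have h' := congrArg Subrepresentation.toSubmodule h
      have : φ ⟨f₀, hf₀⟩ ∈ (⊤ : Subrepresentation ρ).toSubmodule := Submodule.mem_top
      rw [← h'] at this
      exact (Submodule.mem_bot ℂ).1 this
    refine { eq_bot_or_eq_top := fun σ => ?_ }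
    by_cases hσ : σ.toSubmodule.map ψ = ⊥
    · left
      apply Subrepresentation.toSubmodule_injective
      refine (Submodule.eq_bot_iff _).2 fun x hx => hψinj ?_
      rw [map_zero]
      exact (Submodule.mem_bot ℂ).1 (hσ ▸ Submodule.mem_map_of_mem hx)
    · right
      have hle : σ.toSubmodule.map ψ ≤ V₀ := by
        rintro _ ⟨x, -, rfl⟩
        exact hψV x
      have hnot := hmin (σ.toSubmodule.map ψ) ⟨hle.trans hV₀V, hσ, by
        rintro h _ ⟨x, hx, rfl⟩
        exact ⟨ρ h x, σ.apply_mem_toSubmodule h hx, hψρ h x⟩⟩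
      have heq : σ.toSubmodule.map ψ = V₀ := by
        by_contra hne
        exact hnot (lt_of_le_of_ne hle hne)
      apply Subrepresentation.toSubmodule_injective
      refine Submodule.eq_top_iff'.2 fun x => ?_
      obtain ⟨y, hy, hyx⟩ := heq.ge (hψV x)
      rwa [← hψinj hyx]
  have hnontriv : ¬ ρ.IsTrivial := by
    intro ht
    have hconst : ∀ h, f₀ h = f₀ 1 := by
      intro h
      have h1 := hψρ h (φ ⟨f₀, hf₀⟩)
      rw [ht.out h] at h1
      have h2 : ψ (φ ⟨f₀, hf₀⟩) = f₀ := by simp [ψ]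
      simp only [LinearMap.id_coe, id_eq, h2] at h1
      simpa using congrFun h1 h
    have hs := hsum f₀ (hV₀V hf₀)
    simp only [hconst, Finset.sum_const, Finset.card_univ, nsmul_eq_mul] at hs
    have h1 : f₀ 1 = 0 := by
      rcases mul_eq_zero.1 hs with h | h
      · exact absurd h (by exact_mod_cast Fintype.card_ne_zero)
      · exact h
    exact hf₀0 (funext fun h => by simp [hconst h, h1])
  have hle : quasirandomDegree G ≤ Module.finrank ℂ V₀ := Nat.sInf_le ⟨ρ, hirr, hnontriv⟩
  exact hle.trans (Submodule.finrank_mono hV₀V)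

variable {G : Type*} [Group G] [Fintype G] {d : ℕ}

/-- A subspace of real functions on a group that is stable under left translations. -/
def IsLeftInvariant (W : Submodule ℝ (EuclideanSpace ℝ G)) : Prop :=
  ∀ h : G, ∀ f ∈ W, (WithLp.toLp 2 fun g => f (h⁻¹ * g) : EuclideanSpace ℝ G) ∈ W

theorem IsLeftInvariant.quasirandomDegree_le {W : Submodule ℝ (EuclideanSpace ℝ G)}
    (hW : IsLeftInvariant W) (hsum : ∀ f ∈ W, ∑ g, f g = 0) (e : OrthonormalBasis (Fin d) ℝ W)
    (hd : 0 < d) : quasirandomDegree G ≤ d := by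
  set c : Fin d → G → ℂ := fun j g => ((e j : EuclideanSpace ℝ G) g : ℂ) with hc
  have hmem : ∀ f ∈ W, (fun g => (f g : ℂ)) ∈ Submodule.span ℂ (Set.range c) := by
    intro f hf
    have h : (fun g => (f g : ℂ)) = ∑ j, ((e.repr ⟨f, hf⟩ j : ℝ) : ℂ) • c j := by
      ext g
      have h1 := congrArg (fun x : W => (x : EuclideanSpace ℝ G) g) (e.sum_repr ⟨f, hf⟩)
      simp only [Submodule.coe_sum, Submodule.coe_smul, WithLp.ofLp_sum, Finset.sum_apply] at h1
      simp only [← h1, Finset.sum_apply, hc]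
      simp
    rw [h]
    exact Submodule.sum_mem _ fun j _ =>
      Submodule.smul_mem _ _ (Submodule.subset_span ⟨j, rfl⟩)
  have hle := quasirandomDegree_le_finrank (V := Submodule.span ℂ (Set.range c)) ?_ ?_ ?_
  · exact hle.trans ((finrank_range_le_card c).trans_eq (Fintype.card_fin d))
  · intro hbot
    have h0 : c ⟨0, hd⟩ = 0 :=
      (Submodule.mem_bot ℂ).1 (hbot ▸ Submodule.subset_span ⟨⟨0, hd⟩, rfl⟩)
    apply e.orthonormal.ne_zero ⟨0, hd⟩
    ext g
    simpa [hc] using congrFun h0 g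
  · intro h f hf
    induction hf using Submodule.span_induction with
    | mem x hx =>
      obtain ⟨j, rfl⟩ := hx
      exact hmem _ (hW h _ (e j).2)
    | zero => exact Submodule.zero_mem _
    | add x y _ _ hx hy => exact Submodule.add_mem _ hx hy
    | smul a x _ hx => exact Submodule.smul_mem _ a hx
  · intro f hf
    induction hf using Submodule.span_induction with
    | mem x hx =>
      obtain ⟨j, rfl⟩ := hx
      simp only [hc]
      exact_mod_cast hsum _ (e j).2
    | zero => simp
    | add x y _ _ hx hy => simp [Finset.sum_add_distrib, hx, hy]
    | smul a x _ hx => simp [← Finset.mul_sum, hx]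

/-- The right side does not involve the basis, so the diagonal kernel depends on `W` alone. -/
theorem OrthonormalBasis.sum_sq_apply_eq_norm_sq {G : Type*} [Fintype G] [DecidableEq G]
    {W : Submodule ℝ (EuclideanSpace ℝ G)} (e : OrthonormalBasis (Fin d) ℝ W) (g : G) :
    ∑ j, (e j : EuclideanSpace ℝ G) g ^ 2
      = ‖W.orthogonalProjectionOnto (EuclideanSpace.single g 1)‖ ^ 2 := by
  rw [← e.sum_sq_norm_inner_right]
  refine Finset.sum_congr rfl fun j _ => ?_
  rw [Submodule.inner_orthogonalProjectionOnto_eq_of_mem_left, EuclideanSpace.inner_single_right]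
  simp

/-- Translating a basis of `W` gives another one, so the diagonal kernel is constant; its total is
the trace `d`. -/
theorem IsLeftInvariant.sum_sq_apply_eq {W : Submodule ℝ (EuclideanSpace ℝ G)}
    (hW : IsLeftInvariant W) (e : OrthonormalBasis (Fin d) ℝ W) (g : G) :
    ∑ j, (e j : EuclideanSpace ℝ G) g ^ 2 = d / Fintype.card G := by
  classical
  have htrans : ∀ h g, ∑ j, (e j : EuclideanSpace ℝ G) (h⁻¹ * g) ^ 2
      = ∑ j, (e j : EuclideanSpace ℝ G) g ^ 2 := by
    intro h g
    let v : Fin d → W := fun j => ⟨_, hW h (e j) (e j).2⟩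
    have hv : Orthonormal ℝ v := by
      rw [orthonormal_iff_ite]
      intro j k
      rw [← orthonormal_iff_ite.1 e.orthonormal j k]
      simp only [v, Submodule.coe_inner, PiLp.inner_apply]
      exact Equiv.sum_comp (Equiv.mulLeft h⁻¹)
        fun x => inner ℝ ((e j : EuclideanSpace ℝ G) x) ((e k : EuclideanSpace ℝ G) x)
    let b : OrthonormalBasis (Fin d) ℝ W := OrthonormalBasis.mk hv (by
      have hc : Fintype.card (Fin d) = Module.finrank ℝ W := by
        rw [Module.finrank_eq_card_basis e.toBasis]
      exact (hv.linearIndependent.span_eq_top_of_card_eq_finrank' hc).ge)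
    calc _ = ∑ j, (b j : EuclideanSpace ℝ G) g ^ 2 := by simp [b, v]
      _ = _ := by rw [b.sum_sq_apply_eq_norm_sq, e.sum_sq_apply_eq_norm_sq]
  have hconst : ∀ x, ∑ j, (e j : EuclideanSpace ℝ G) x ^ 2
      = ∑ j, (e j : EuclideanSpace ℝ G) g ^ 2 := fun x => by
    simpa using htrans (g * x⁻¹) g
  have htotal : ∑ x, ∑ j, (e j : EuclideanSpace ℝ G) x ^ 2 = d := by
    rw [Finset.sum_comm]
    have : ∀ j, ∑ x, (e j : EuclideanSpace ℝ G) x ^ 2 = 1 := fun j => by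
      have h : ‖(e j : EuclideanSpace ℝ G)‖ = 1 := e.orthonormal.norm_eq_one j
      rw [EuclideanSpace.norm_eq, Real.sqrt_eq_one] at h
      simpa using h
    simp [this]
  simp only [hconst, Finset.sum_const, Finset.card_univ, nsmul_eq_mul] at htotal
  rw [← htotal]
  field_simp

end LeftInvariant

/-! ### The union bound with moment order `⌈log n⌉`. -/

section Numerics

theorem union_bound_lt_one {κ : Type*} [Fintype κ] {c n d s ε L K : ℝ} (hc : 0 < c)
    (hn : 3 ≤ n) (hL : L = Real.log n) (hK : K = √(128 * Real.exp 4 / c)) (hds : n ^ s ≤ d)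
    (hdn : d ≤ n) (hκ : (Fintype.card κ : ℝ) ≤ n) (a : κ → ℝ)
    (ha : ∀ i, c * n ^ (1 - (s - ε)) ≤ a i) :
    d * ∑ i, (2 * (4 * (⌈L⌉₊ : ℝ)) ^ 2 * (a i / n / d) / (K * L / n ^ (ε / 2) * (a i / n)) ^ 2)
      ^ ⌈L⌉₊ < 1 := by
  have hn0 : 0 < n := by linarith
  -- This is where `3 ≤ n` is needed: `e < 3` gives `L ≥ 1`, hence `⌈L⌉₊ ≤ 2 * L`.
  have hL1 : 1 ≤ L := by
    rw [hL, Real.le_log_iff_exp_le hn0]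
    linarith [Real.exp_one_lt_d9]
  set p := ⌈L⌉₊ with hp
  have hpL : L ≤ p := Nat.le_ceil L
  have hpL2 : (p : ℝ) ≤ 2 * L := by linarith [Nat.ceil_lt_add_one (by linarith : 0 ≤ L)]
  have hd0 : 0 < d := lt_of_lt_of_le (by positivity) hds
  have hKsq : K ^ 2 = 128 * Real.exp 4 / c := by rw [hK, Real.sq_sqrt (by positivity)]
  have hK0 : 0 < K := by rw [hK]; positivity
  have hterm : ∀ i, (2 * (4 * (p : ℝ)) ^ 2 * (a i / n / d) /
      (K * L / n ^ (ε / 2) * (a i / n)) ^ 2) ^ p ≤ 1 / n ^ 4 := by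
    intro i
    have hai : 0 < a i := lt_of_lt_of_le (by positivity) (ha i)
    have hprod : c * n ^ ε * n ≤ a i * d := by
      calc c * n ^ ε * n = (c * n ^ (1 - (s - ε))) * n ^ s := by
            rw [mul_assoc, mul_assoc, ← Real.rpow_add hn0]
            nth_rewrite 2 [← Real.rpow_one n]
            rw [← Real.rpow_add hn0]; ring_nf
        _ ≤ a i * d := by gcongr; exact ha i
    have hhalf : (n ^ (ε / 2)) ^ 2 = n ^ ε := by
      rw [← Real.rpow_natCast, ← Real.rpow_mul hn0.le]; norm_num
    -- `K` is chosen for this: `2 * (4 * p) ^ 2 ≤ 128 * L ^ 2`, and the factor `exp 4` makes the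
    -- `p`-th power at most `n ^ (-4)`, which beats at most `n ^ 2` events.
    have hbase : 2 * (4 * (p : ℝ)) ^ 2 * (a i / n / d) /
        (K * L / n ^ (ε / 2) * (a i / n)) ^ 2 ≤ Real.exp (-4) := by
      calc _ = 32 * (p : ℝ) ^ 2 * (n ^ ε * n) / (K ^ 2 * L ^ 2 * (a i * d)) := by
            rw [mul_pow _ (a i / n), div_pow, hhalf, mul_pow]; field_simp; ring
        _ ≤ 32 * (2 * L) ^ 2 * (n ^ ε * n) / (K ^ 2 * L ^ 2 * (c * n ^ ε * n)) := by gcongr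
        _ = 128 / (K ^ 2 * c) := by field_simp; ring
        _ = 1 / Real.exp 4 := by rw [hKsq]; field_simp
        _ = _ := by rw [Real.exp_neg, one_div]
    calc _ ≤ Real.exp (-4) ^ p := by gcongr
      _ = Real.exp (-(4 * p)) := by rw [← Real.exp_nat_mul]; ring_nf
      _ ≤ Real.exp (-(4 * L)) := by gcongr
      _ = 1 / n ^ 4 := by
        rw [Real.exp_neg, one_div, show (4 : ℝ) * L = (4 : ℕ) * L by norm_num, Real.exp_nat_mul,
          hL, Real.exp_log hn0]
  calc _ ≤ d * ∑ _i : κ, 1 / n ^ 4 := by gcongr with i; exact hterm i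
    _ = d * (Fintype.card κ * (1 / n ^ 4)) := by simp
    _ ≤ n * (n * (1 / n ^ 4)) := by gcongr
    _ = 1 / n ^ 2 := by field_simp
    _ < 1 := by rw [div_lt_one (by positivity)]; nlinarith

end Numerics

/-! ### Spectral decomposition of the Cayley graph and its complexification. -/

section Cayley

variable {G : Type*} [Group G]

/-- The adjacency operator of a Cayley graph on real-valued functions. -/
def realCayleyAdjacency (S : Finset G) : EuclideanSpace ℝ G →ₗ[ℝ] EuclideanSpace ℝ G where
  toFun f := WithLp.toLp 2 fun g => ∑ s ∈ S, f (g * s)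
  map_add' f h := by
    ext g
    simp [Finset.sum_add_distrib]
  map_smul' a f := by
    ext g
    simp [Finset.mul_sum]

theorem realCayleyAdjacency_apply (S : Finset G) (f : EuclideanSpace ℝ G) (g : G) :
    realCayleyAdjacency S f g = ∑ s ∈ S, f (g * s) := rfl

theorem realCayleyAdjacency_translate (S : Finset G) (f : EuclideanSpace ℝ G) (h g : G) :
    realCayleyAdjacency S (WithLp.toLp 2 fun g => f (h⁻¹ * g)) g
      = realCayleyAdjacency S f (h⁻¹ * g) := by
  simp [realCayleyAdjacency_apply, mul_assoc]

variable [Fintype G]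

theorem realCayleyAdjacency_univ_apply (f : EuclideanSpace ℝ G) (g : G) :
    realCayleyAdjacency Finset.univ f g = ∑ x, f x :=
  Equiv.sum_comp (Equiv.mulLeft g) f

theorem sum_realCayleyAdjacency (S : Finset G) (f : EuclideanSpace ℝ G) :
    ∑ g, realCayleyAdjacency S f g = S.card * ∑ g, f g := by
  simp only [realCayleyAdjacency_apply]
  rw [Finset.sum_comm]
  have : ∀ s, ∑ g, f (g * s) = ∑ g, f g := fun s => Equiv.sum_comp (Equiv.mulRight s) f
  simp [this]

theorem realCayleyAdjacency_isSymmetric {S : Finset G} (hS : ∀ x ∈ S, x⁻¹ ∈ S) :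
    (realCayleyAdjacency S).IsSymmetric := by
  intro f h
  simp only [PiLp.inner_apply, realCayleyAdjacency_apply, inner_sum, sum_inner]
  rw [Finset.sum_comm]
  conv_rhs => rw [Finset.sum_comm]
  refine Finset.sum_bij (fun s _ => s⁻¹) hS (fun _ _ _ _ h => inv_injective h)
    (fun s hs => ⟨s⁻¹, hS s hs, inv_inv s⟩) fun s _ => ?_
  rw [← Equiv.sum_comp (Equiv.mulRight s) fun g => inner ℝ (f g) (h (g * s⁻¹))]
  simp

/-- A perturbation of the adjacency operator that moves the constants to another eigenvalue. -/
def perturbedAdjacency (S : Finset G) (t : ℝ) : EuclideanSpace ℝ G →ₗ[ℝ] EuclideanSpace ℝ G :=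
  realCayleyAdjacency S + t • realCayleyAdjacency Finset.univ

theorem perturbedAdjacency_apply (S : Finset G) (t : ℝ) (f : EuclideanSpace ℝ G) (g : G) :
    perturbedAdjacency S t f g = realCayleyAdjacency S f g + t * ∑ x, f x := by
  simp [perturbedAdjacency, realCayleyAdjacency_univ_apply]

theorem perturbedAdjacency_isSymmetric {S : Finset G} (hS : ∀ x ∈ S, x⁻¹ ∈ S) (t : ℝ) :
    (perturbedAdjacency S t).IsSymmetric :=
  (realCayleyAdjacency_isSymmetric hS).add
    ((realCayleyAdjacency_isSymmetric (by simp)).smul (by simp))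

theorem isLeftInvariant_eigenspace (S : Finset G) (t μ : ℝ) :
    IsLeftInvariant (Module.End.eigenspace (perturbedAdjacency S t) μ) := by
  intro h f hf
  rw [Module.End.mem_eigenspace_iff] at hf ⊢
  ext g
  have h1 := congrArg (fun x : EuclideanSpace ℝ G => x (h⁻¹ * g)) hf
  simp only [perturbedAdjacency_apply, realCayleyAdjacency_translate] at h1 ⊢
  have h2 : ∑ x, f (h⁻¹ * x) = ∑ x, f x := Equiv.sum_comp (Equiv.mulLeft h⁻¹) f
  simpa [h2] using h1

/-- The eigenspaces of a suitable perturbation consist of eigenvectors of the adjacency operator,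
and each of them is orthogonal to the constants or contained in them. -/
theorem exists_perturbedAdjacency_eigenspace (S : Finset G) :
    ∃ t : ℝ, ∀ μ : ℝ, ∃ lam : ℝ,
      (∀ f ∈ Module.End.eigenspace (perturbedAdjacency S t) μ,
        realCayleyAdjacency S f = lam • f) ∧
      ((∀ f ∈ Module.End.eigenspace (perturbedAdjacency S t) μ, ∑ g, f g = 0) ∨
       (∀ f ∈ Module.End.eigenspace (perturbedAdjacency S t) μ, ∃ a : ℝ, ∀ g, f g = a)) := by
  obtain ⟨ν, hν⟩ : ∃ ν, ¬ Module.End.HasEigenvalue (realCayleyAdjacency S) ν :=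
    (Module.End.finite_hasEigenvalue (realCayleyAdjacency S)).exists_notMem
  have hn : (Fintype.card G : ℝ) ≠ 0 := by exact_mod_cast Fintype.card_ne_zero
  -- This shift moves the eigenvalue of the constants from `|S|` to `ν`, which the unperturbed
  -- operator does not have.
  refine ⟨(ν - S.card) / Fintype.card G, fun μ => ?_⟩
  set t := (ν - S.card) / (Fintype.card G : ℝ) with ht
  have htn : Fintype.card G * t = ν - S.card := by rw [ht]; field_simp
  have heig : ∀ f ∈ Module.End.eigenspace (perturbedAdjacency S t) μ, ∀ g,
      realCayleyAdjacency S f g + t * ∑ x, f x = μ * f g := by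
    intro f hf g
    rw [Module.End.mem_eigenspace_iff] at hf
    rw [← perturbedAdjacency_apply, hf]
    simp
  have hsum : ∀ f ∈ Module.End.eigenspace (perturbedAdjacency S t) μ,
      ν * ∑ x, f x = μ * ∑ x, f x := by
    intro f hf
    have h := Finset.sum_congr (s₁ := Finset.univ) rfl fun g _ => heig f hf g
    rw [Finset.sum_add_distrib, sum_realCayleyAdjacency, Finset.sum_const, ← Finset.mul_sum,
      Finset.card_univ, nsmul_eq_mul, ← mul_assoc, htn] at h
    linarith
  by_cases hμ : μ = ν
  · have hconst : ∀ f ∈ Module.End.eigenspace (perturbedAdjacency S t) μ, ∀ g,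
        f g = (∑ x, f x) / Fintype.card G := by
      intro f hf
      set m := (∑ x, f x) / (Fintype.card G : ℝ) with hm
      have hsm : ∑ x, f x = Fintype.card G * m := by rw [hm]; field_simp
      -- The mean-free part of `f` would be an eigenvector of the unperturbed operator for `ν`, so
      -- it vanishes.
      set y : EuclideanSpace ℝ G := WithLp.toLp 2 fun g => f g - m with hy
      have hTy : realCayleyAdjacency S y = ν • y := by
        ext g
        have h1 := heig f hf g
        rw [hsm, hμ, ← mul_assoc, mul_comm t, htn] at h1
        rw [realCayleyAdjacency_apply] at h1 ⊢
        simp only [hy, Finset.sum_sub_distrib, Finset.sum_const, nsmul_eq_mul, PiLp.smul_apply,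
          smul_eq_mul]
        linarith
      have hy0 : y = 0 := by
        by_contra hne
        exact hν (Module.End.hasEigenvalue_of_hasEigenvector
          ⟨Module.End.mem_eigenspace_iff.2 hTy, hne⟩)
      intro g
      have := congrArg (fun x : EuclideanSpace ℝ G => x g) hy0
      simpa [hy, sub_eq_zero] using this
    refine ⟨S.card, fun f hf => ?_, Or.inr fun f hf => ⟨_, hconst f hf⟩⟩
    ext g
    rw [realCayleyAdjacency_apply]
    simp only [PiLp.smul_apply, smul_eq_mul]
    rw [Finset.sum_congr rfl fun s _ => hconst f hf (g * s), hconst f hf g]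
    simp
  · have hzero : ∀ f ∈ Module.End.eigenspace (perturbedAdjacency S t) μ, ∑ g, f g = 0 := by
      intro f hf
      by_contra hne
      exact hμ (mul_right_cancel₀ hne (hsum f hf)).symm
    refine ⟨μ, fun f hf => ?_, Or.inl hzero⟩
    ext g
    simpa [hzero f hf] using heig f hf g

theorem sum_sq_eq_of_const {f : EuclideanSpace ℝ G} (hf : ‖f‖ = 1) {a : ℝ} (ha : ∀ g, f g = a)
    (A : Finset G) : ∑ g ∈ A, f g ^ 2 = A.card / Fintype.card G := by
  have hn : (Fintype.card G : ℝ) ≠ 0 := by exact_mod_cast Fintype.card_ne_zero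
  rw [EuclideanSpace.norm_eq, Real.sqrt_eq_one] at hf
  have : (Fintype.card G : ℝ) * a ^ 2 = 1 := by simpa [ha] using hf
  simp only [ha, Finset.sum_const, nsmul_eq_mul]
  rw [eq_div_iff hn, mul_assoc, mul_comm (a ^ 2), this, mul_one]

/-- Reduces the choice of an eigenbasis with property `P` to constants and to invariant spaces of
mean zero, by collecting bases of the perturbed eigenspaces. -/
theorem exists_real_eigenbasis {S : Finset G} (hS : ∀ x ∈ S, x⁻¹ ∈ S)
    {P : EuclideanSpace ℝ G → Prop}
    (hconst : ∀ f : EuclideanSpace ℝ G, ‖f‖ = 1 → (∃ a : ℝ, ∀ g, f g = a) → P f)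
    (hP : ∀ (d : ℕ) (W : Submodule ℝ (EuclideanSpace ℝ G)), 0 < d → IsLeftInvariant W →
      (∀ f ∈ W, ∑ g, f g = 0) → OrthonormalBasis (Fin d) ℝ W →
      ∃ b : OrthonormalBasis (Fin d) ℝ W, ∀ k, P (b k)) :
    ∃ b : OrthonormalBasis G ℝ (EuclideanSpace ℝ G), ∀ k,
      (∃ lam : ℝ, realCayleyAdjacency S (b k) = lam • b k) ∧ P (b k) := by
  classical
  obtain ⟨t, ht⟩ := exists_perturbedAdjacency_eigenspace S
  set T := perturbedAdjacency S t with hT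
  have hsymm : T.IsSymmetric := perturbedAdjacency_isSymmetric hS t
  have hbasis : ∀ μ : Module.End.Eigenvalues T,
      ∃ b : OrthonormalBasis (Fin (Module.finrank ℝ (Module.End.eigenspace T (μ : ℝ)))) ℝ
        (Module.End.eigenspace T (μ : ℝ)), ∀ k, P (b k) := by
    intro μ
    obtain ⟨lam, -, h | h⟩ := ht μ
    · rcases Nat.eq_zero_or_pos (Module.finrank ℝ (Module.End.eigenspace T (μ : ℝ))) with h0 | h0
      · exact ⟨stdOrthonormalBasis ℝ _, fun k => absurd k.2 (by omega)⟩
      · exact hP _ _ h0 (isLeftInvariant_eigenspace S t _) h (stdOrthonormalBasis ℝ _)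
    · exact ⟨stdOrthonormalBasis ℝ _, fun k => hconst _
        ((stdOrthonormalBasis ℝ (Module.End.eigenspace T (μ : ℝ))).orthonormal.norm_eq_one k)
        (h _ (Subtype.prop _))⟩
  choose v hv using hbasis
  let B := hsymm.direct_sum_isInternal.collectedOrthonormalBasis
    hsymm.orthogonalFamily_eigenspaces' v
  have hcard : Fintype.card ((μ : Module.End.Eigenvalues T) ×
      Fin (Module.finrank ℝ (Module.End.eigenspace T (μ : ℝ)))) = Fintype.card G := by
    rw [← Module.finrank_eq_card_basis B.toBasis, finrank_euclideanSpace]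
  refine ⟨B.reindex (Fintype.equivOfCardEq hcard), fun k => ?_⟩
  rw [OrthonormalBasis.reindex_apply]
  set x := (Fintype.equivOfCardEq hcard).symm k
  have hBx : B x = v x.1 x.2 := by
    simp [B, DirectSum.IsInternal.collectedOrthonormalBasis]
  obtain ⟨lam, hlam, -⟩ := ht x.1
  rw [hBx]
  exact ⟨⟨lam, hlam _ (v x.1 x.2).2⟩, hv x.1 x.2⟩

theorem exists_complexified_orthonormalBasis {G : Type*} [Fintype G]
    (b : OrthonormalBasis G ℝ (EuclideanSpace ℝ G)) :
    ∃ B : OrthonormalBasis G ℂ (EuclideanSpace ℂ G), ∀ k g, B k g = (b k g : ℂ) := by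
  classical
  let v : G → EuclideanSpace ℂ G := fun k => WithLp.toLp 2 fun g => (b k g : ℂ)
  have hv : Orthonormal ℂ v := by
    rw [orthonormal_iff_ite]
    intro j k
    have h := orthonormal_iff_ite.1 b.orthonormal j k
    simp only [PiLp.inner_apply, RCLike.inner_apply, conj_trivial] at h
    simp only [v, PiLp.inner_apply, RCLike.inner_apply, Complex.conj_ofReal]
    have h' := congrArg (fun x : ℝ => (x : ℂ)) h
    push_cast at h'
    rw [h']
    split_ifs <;> simp
  refine ⟨OrthonormalBasis.mk hv (hv.linearIndependent.span_eq_top_of_card_eq_finrank'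
    (by simp)).ge, fun k g => by simp [v]⟩

end Cayley

/-! ### Assembly of the theorem. -/

theorem corollary1p6 (c : ℝ) (hc : 0 < c) :
    ∃ K : ℝ, 0 < K ∧
      ∀ η : ℝ, 0 < η →
        ∃ N₀ : ℕ,
          ∀ s ε C : ℝ, 0 < ε → ε < s → η = s - ε → 0 < C →
          ∀ (G : Type*) [Group G] [Fintype G] (S : Finset G),
            (∀ x ∈ S, x⁻¹ ∈ S) →
            N₀ ≤ Fintype.card G →
            (Fintype.card G : ℝ) ^ s ≤ (quasirandomDegree G : ℝ) →
          ∀ (ι : Type*) (A : ι → Finset G),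
            (∀ i j, i ≠ j → Disjoint (A i) (A j)) →
            (∀ g : G, ∃ i, g ∈ A i) →
            (∀ i, c * (Fintype.card G : ℝ) ^ (1 - η) ≤ ((A i).card : ℝ) ∧
              ((A i).card : ℝ) ≤ C * (Fintype.card G : ℝ) ^ (1 - η)) →
            ∃ b : OrthonormalBasis G ℂ (EuclideanSpace ℂ G),
              ∀ k : G,
                (∃ lam : ℂ, Module.End.HasEigenvector (cayleyAdjacency S) lam (b k)) ∧
                (∀ g : G, (b k g).im = 0) ∧
                ∀ i,
                  |quantumMass (b k) (A i) - ((A i).card : ℝ) / (Fintype.card G : ℝ)| ≤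
                    K * Real.log (Fintype.card G : ℝ) / (Fintype.card G : ℝ) ^ (ε / 2) *
                      (((A i).card : ℝ) / (Fintype.card G : ℝ)) := by
  -- The threshold `3` serves for every `η`.
  refine ⟨√(128 * Real.exp 4 / c), by positivity, fun η _ => ⟨3, ?_⟩⟩
  intro s ε C _ _ hηs _ G _ _ S hS hG hquasi ι A hdisj _ hA
  subst hηs
  have hn : (3 : ℝ) ≤ Fintype.card G := by exact_mod_cast hG
  have hn0 : (0 : ℝ) < Fintype.card G := by linarith
  have hlog : 0 < Real.log (Fintype.card G) := Real.log_pos (by linarith)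
  have hAcard : ∀ i, (0 : ℝ) < (A i).card := fun i => lt_of_lt_of_le (by positivity) (hA i).1
  -- Representatives of the disjoint nonempty sets show that the index type is finite with at most
  -- `|G|` elements.
  choose r hr using fun i => Finset.card_pos.1 (by exact_mod_cast hAcard i : 0 < (A i).card)
  have hrinj : Function.Injective r := by
    intro i j hij
    by_contra hne
    exact Finset.disjoint_left.1 (hdisj i j hne) (hr i) (hij ▸ hr j)
  have : Fintype ι := Fintype.ofInjective r hrinj
  have hι : (Fintype.card ι : ℝ) ≤ Fintype.card G := by
    exact_mod_cast Fintype.card_le_of_injective r hrinj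
  set t : ι → ℝ := fun i => √(128 * Real.exp 4 / c) * Real.log (Fintype.card G) /
    (Fintype.card G : ℝ) ^ (ε / 2) * (((A i).card : ℝ) / (Fintype.card G : ℝ)) with ht
  have ht0 : ∀ i, 0 < t i := fun i => by
    have := hAcard i
    simp only [ht]
    positivity
  obtain ⟨b, hb⟩ := exists_real_eigenbasis hS
    (P := fun f => ∀ i, |∑ g ∈ A i, f g ^ 2 - (A i).card / Fintype.card G| ≤ t i)
    (by
      rintro f hf ⟨a, ha⟩ i
      rw [sum_sq_eq_of_const hf ha, sub_self, abs_zero]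
      exact (ht0 i).le)
    (by
      intro d W hd hW hsum e
      refine exists_orthonormalBasis_equidistributed e hd hn0 (hW.sum_sq_apply_eq e) A t ht0
        (Nat.ceil_pos.2 hlog).ne' ?_
      refine union_bound_lt_one hc hn rfl rfl (hquasi.trans ?_) ?_ hι _ fun i => (hA i).1
      · exact_mod_cast hW.quasirandomDegree_le hsum e hd
      · have h := Submodule.finrank_le W
        rw [Module.finrank_eq_card_basis e.toBasis, finrank_euclideanSpace, Fintype.card_fin] at h
        exact_mod_cast h)
  obtain ⟨B, hB⟩ := exists_complexified_orthonormalBasis b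
  refine ⟨B, fun k => ⟨?_, fun g => by rw [hB, Complex.ofReal_im], fun i => ?_⟩⟩
  · obtain ⟨lam, hlam⟩ := (hb k).1
    refine ⟨lam, Module.End.mem_eigenspace_iff.2 ?_, B.orthonormal.ne_zero k⟩
    ext g
    have h := congrArg (fun f : EuclideanSpace ℝ G => ((f g : ℝ) : ℂ)) hlam
    simpa [cayleyAdjacency, realCayleyAdjacency_apply, hB] using h
  · rw [quantumMass_eq_sum]
    simpa [hB] using (hb k).2 i
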